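/- Let $n \ge 2$. Index the computational basis of $(\mathbb{C}^2)^{\otimes n}$ by bit strings, and for a $2\times 2$ matrix $A$ write $A_i$ for $A$ acting on qubit $i$ and the identity on the other qubits. The $n$-qubit Pauli group consists of the operators $i^k\, P_1\otimes\cdots\otimes P_n$ with $k\in\mathbb{Z}$ and each $P_j\in\{I,X,Y,Z\}$. An $n$-qubit Clifford unitary is a unitary operator $C$ on $(\mathbb{C}^2)^{\otimes n}$ that normalizes the Pauli group (that is, $CAC^\dagger$ is in the Pauli group if and only if $A$ is). A local Clifford gate is $U_i$, for a qubit $i$ and a one-qubit Clifford unitary $U$ (scalar phases are included). For a set $S$ of qubits and $\alpha\in\mathbb{R}$, the targeted global Mølmer–Sørensen gate is $$\mathrm{GMS}_S(\alpha)=\exp\Bigl(-i\,\frac{\alpha}{4}\sum_{\substack{j,k\in S\\ j\neq k}} X_jX_k\Bigr),$$ the sum being over ordered pairs. Theorem. Every $n$-qubit Clifford unitary $C$ can be implemented using local Clifford gates and at most $6n-8$ targeted GMS gates: $C$ is equal to a finite product of local Clifford gates and gates $\mathrm{GMS}_S(\alpha)$ (where $S$ and $\alpha$ may differ from gate to gate),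 in which at most $6n-8$ of the factors are GMS gates. -/

import Mathlib

open scoped Matrix

noncomputable section

namespace Qubits

/-- Operators on `n` qubits, as matrices in the computational basis: the basis vectors are
indexed by bit strings `Fin n → Fin 2`. -/
abbrev Op (n : ℕ) : Type := Matrix (Fin n → Fin 2) (Fin n → Fin 2) ℂ

/-- The tensor product `M 0 ⊗ M 1 ⊗ ⋯ ⊗ M (n - 1)` of one-qubit operators. -/
def tensor {n : ℕ} (M : Fin n → Matrix (Fin 2) (Fin 2) ℂ) : Op n :=
  fun x y => ∏ k, M k (x k) (y k)

/-- The one-qubit operator `U` applied to qubit `i`, with the identity on all other qubits. -/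
def onQubit {n : ℕ} (i : Fin n) (U : Matrix (Fin 2) (Fin 2) ℂ) : Op n :=
  tensor (Function.update (fun _ => 1) i U)

/-- The Pauli matrix `X`. -/
def pauliX : Matrix (Fin 2) (Fin 2) ℂ := !![0, 1; 1, 0]

/-- The Pauli matrix `Y`. -/
def pauliY : Matrix (Fin 2) (Fin 2) ℂ := !![0, -Complex.I; Complex.I, 0]

/-- The Pauli matrix `Z`. -/
def pauliZ : Matrix (Fin 2) (Fin 2) ℂ := !![1, 0; 0, -1]

/-- The four one-qubit Pauli operators `I, X, Y, Z`. -/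
def pauli : Fin 4 → Matrix (Fin 2) (Fin 2) ℂ := ![1, pauliX, pauliY, pauliZ]

/-- The `n`-qubit Pauli group: Pauli strings with a phase from `{1, i, -1, -i}`. -/
def pauliGroup (n : ℕ) : Set (Op n) :=
  {A | ∃ (k : ℕ) (p : Fin n → Fin 4), A = Complex.I ^ k • tensor (fun j => pauli (p j))}

/-- A Clifford unitary: a unitary operator that normalizes the Pauli group. -/
def IsClifford {n : ℕ} (U : Op n) : Prop :=
  U ∈ Matrix.unitaryGroup (Fin n → Fin 2) ℂ ∧
    ∀ A : Op n, U * A * Uᴴ ∈ pauliGroup n ↔ A ∈ pauliGroup n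

/-- A one-qubit Clifford unitary, given as a `2 × 2` matrix. -/
def IsSingleQubitClifford (U : Matrix (Fin 2) (Fin 2) ℂ) : Prop :=
  IsClifford (tensor (fun _ : Fin 1 => U))

/-- The targeted global Mølmer-Sørensen gate
`GMS_S(α) = exp(-i (α / 4) ∑_{i ≠ j ∈ S} X_i X_j)`, the sum being over ordered pairs. -/
def GMS {n : ℕ} (S : Finset (Fin n)) (α : ℝ) : Op n :=
  NormedSpace.exp ((-Complex.I * ((α : ℂ) / 4)) •
    ∑ p ∈ S.offDiag, onQubit p.1 pauliX * onQubit p.2 pauliX)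

/-- The gate set: one-qubit Clifford unitaries on any qubit, and GMS gates on any set of qubits
with any angle. -/
inductive Gate (n : ℕ) : Type
  | localClifford (i : Fin n) (U : Matrix (Fin 2) (Fin 2) ℂ) (hU : IsSingleQubitClifford U)
  | gms (S : Finset (Fin n)) (α : ℝ)

/-- The operator of a gate. -/
def Gate.op {n : ℕ} : Gate n → Op n
  | .localClifford i U _ => onQubit i U
  | .gms S α => GMS S α

/-- The number of GMS gates that a gate counts for. -/
def Gate.cost {n : ℕ} : Gate n → ℕ
  | .localClifford _ _ _ => 0
  | .gms _ _ => 1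

/-- A circuit: a finite sequence of gates, the head of the list being applied first. -/
abbrev Circuit (n : ℕ) : Type := List (Gate n)

/-- The operator implemented by a circuit. -/
def Circuit.op {n : ℕ} : Circuit n → Op n
  | [] => 1
  | g :: c => Circuit.op c * g.op

/-- The number of GMS gates in a circuit. -/
def Circuit.gmsCount {n : ℕ} (c : Circuit n) : ℕ := (c.map Gate.cost).sum

end Qubits

end

namespace Qubits

/-! ### Tensor products of one-qubit operators -/

/-! The operator is peeled off one qubit at a time, at most three GMS gates per qubit and none for
the last one. This gives the bound 3(n - 1), which is at most 6n - 8 when n ≥ 2.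

The engine is `GMS_conj_pauliString`. Let N and R be the qubits of S at which a Pauli string
anticommutes, respectively commutes, with X. Conjugation by GMS_S(π/2) multiplies the string, up to
phase, by the product of X_j X_k over j ∈ N and k ∈ R. If local Cliffords first turn the string into
Z at i and X on the rest of its support, then N = {i}, and one gate on the whole support erases
every factor away from i (`exists_map_to_onQubit_pauliZ`).

A Clifford C acts trivially on qubit i once it fixes X_i and Z_i under conjugation. In
`exists_map_commute` one gate makes the image of X_i nontrivial at i, a second shrinks that image to
qubit i, and a third shrinks the image of Z_i while preserving X_i up to phase; a Pauli at i then
repairs the signs. Induction on the set of active qubits (`IsCliffordOn.implementable`) ends at a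
scalar, which is absorbed in a local gate. -/

lemma tensor_mul {n : ℕ} (M N : Fin n → Matrix (Fin 2) (Fin 2) ℂ) :
    tensor M * tensor N = tensor (fun k => M k * N k) := by
  ext x y
  simp only [tensor, Matrix.mul_apply, ← Finset.prod_mul_distrib]
  rw [Finset.prod_univ_sum, Fintype.piFinset_univ]

lemma tensor_one {n : ℕ} : tensor (fun _ : Fin n => (1 : Matrix (Fin 2) (Fin 2) ℂ)) = 1 := by
  ext x y
  by_cases h : x = y
  · subst h; simp [tensor]
  · obtain ⟨k, hk⟩ := Function.ne_iff.mp h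
    rw [Matrix.one_apply_ne h]
    exact Finset.prod_eq_zero (Finset.mem_univ k) (Matrix.one_apply_ne hk)

lemma tensor_smul {n : ℕ} (c : Fin n → ℂ) (M : Fin n → Matrix (Fin 2) (Fin 2) ℂ) :
    tensor (fun k => c k • M k) = (∏ k, c k) • tensor M := by
  ext x y
  simp [tensor, Finset.prod_mul_distrib]

lemma conjTranspose_tensor {n : ℕ} (M : Fin n → Matrix (Fin 2) (Fin 2) ℂ) :
    (tensor M)ᴴ = tensor (fun k => (M k)ᴴ) := by
  ext x y
  simp [tensor, Matrix.conjTranspose_apply]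

lemma onQubit_mul_tensor {n : ℕ} (i : Fin n) (U : Matrix (Fin 2) (Fin 2) ℂ)
    (M : Fin n → Matrix (Fin 2) (Fin 2) ℂ) :
    onQubit i U * tensor M = tensor (Function.update M i (U * M i)) := by
  rw [onQubit, tensor_mul]
  congr 1
  ext1 k
  by_cases h : k = i
  · subst h; simp
  · simp [h]

lemma tensor_mul_onQubit {n : ℕ} (i : Fin n) (U : Matrix (Fin 2) (Fin 2) ℂ)
    (M : Fin n → Matrix (Fin 2) (Fin 2) ℂ) :
    tensor M * onQubit i U = tensor (Function.update M i (M i * U)) := by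
  rw [onQubit, tensor_mul]
  congr 1
  ext1 k
  by_cases h : k = i
  · subst h; simp
  · simp [h]

lemma tensor_update_smul {n : ℕ} (i : Fin n) (c : ℂ) (U : Matrix (Fin 2) (Fin 2) ℂ)
    (M : Fin n → Matrix (Fin 2) (Fin 2) ℂ) :
    tensor (Function.update M i (c • U)) = c • tensor (Function.update M i U) := by
  have : Function.update M i (c • U)
      = fun k => (if k = i then c else 1) • Function.update M i U k := by
    ext1 k
    by_cases h : k = i
    · subst h; simp
    · simp [h]
  rw [this, tensor_smul]
  simp

lemma onQubit_smul {n : ℕ} (i : Fin n) (c : ℂ) (U : Matrix (Fin 2) (Fin 2) ℂ) :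
    onQubit i (c • U) = c • onQubit i U := tensor_update_smul i c U _

lemma onQubit_one {n : ℕ} (i : Fin n) : onQubit i 1 = 1 := by
  rw [onQubit, Function.update_eq_self_iff.mpr rfl, tensor_one]

lemma onQubit_mul {n : ℕ} (i : Fin n) (U V : Matrix (Fin 2) (Fin 2) ℂ) :
    onQubit i U * onQubit i V = onQubit i (U * V) := by
  nth_rewrite 2 [onQubit]
  rw [onQubit_mul_tensor]
  simp [onQubit]

lemma conjTranspose_onQubit {n : ℕ} (i : Fin n) (U : Matrix (Fin 2) (Fin 2) ℂ) :
    (onQubit i U)ᴴ = onQubit i Uᴴ := by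
  rw [onQubit, conjTranspose_tensor, onQubit]
  congr 1
  ext1 k
  by_cases h : k = i
  · subst h; simp
  · simp [h]

/-- A product operator commutes with a one-qubit operator if its factor on that qubit does. -/
lemma commute_tensor_onQubit {n : ℕ} (i : Fin n) (U : Matrix (Fin 2) (Fin 2) ℂ)
    (M : Fin n → Matrix (Fin 2) (Fin 2) ℂ) (h : Commute (M i) U) :
    Commute (tensor M) (onQubit i U) := by
  rw [Commute, SemiconjBy, tensor_mul_onQubit, onQubit_mul_tensor, h.eq]

lemma commute_onQubit {n : ℕ} {i j : Fin n} (h : i ≠ j) (U V : Matrix (Fin 2) (Fin 2) ℂ) :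
    Commute (onQubit i U) (onQubit j V) := by
  apply commute_tensor_onQubit
  simp [h.symm]

/-! ### Pauli strings -/

/-- The sign with which `X` commutes past a Pauli operator. -/
def signX : Fin 4 → ℂ := ![1, 1, -1, -1]

/-- The sign with which `Z` commutes past a Pauli operator. -/
def signZ : Fin 4 → ℂ := ![1, -1, -1, 1]

lemma pauliX_mul_pauli (a : Fin 4) : pauliX * pauli a = signX a • (pauli a * pauliX) := by
  fin_cases a <;> ext i j <;> fin_cases i <;> fin_cases j <;>
    simp [pauli, pauliX, pauliY, pauliZ, signX]

lemma pauliZ_mul_pauli (a : Fin 4) : pauliZ * pauli a = signZ a • (pauli a * pauliZ) := by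
  fin_cases a <;> ext i j <;> fin_cases i <;> fin_cases j <;>
    simp [pauli, pauliX, pauliY, pauliZ, signZ]

lemma pauli_mul_self (a : Fin 4) : pauli a * pauli a = 1 := by
  fin_cases a <;> ext i j <;> fin_cases i <;> fin_cases j <;>
    simp [pauli, pauliX, pauliY, pauliZ]

lemma conjTranspose_pauli (a : Fin 4) : (pauli a)ᴴ = pauli a := by
  fin_cases a <;> ext i j <;> fin_cases i <;> fin_cases j <;>
    simp [pauli, pauliX, pauliY, pauliZ, Matrix.conjTranspose_apply]

lemma signX_mul_self (a : Fin 4) : signX a * signX a = 1 := by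
  fin_cases a <;> simp [signX]

lemma signX_ne_one_iff (a : Fin 4) : signX a ≠ 1 ↔ a = 2 ∨ a = 3 := by
  fin_cases a <;> norm_num [signX] <;> decide

lemma eq_zero_of_signs (a : Fin 4) (hx : signX a = 1) (hz : signZ a = 1) : a = 0 := by
  fin_cases a
  · rfl
  · norm_num [signZ] at hz
  · norm_num [signX] at hx
  · norm_num [signX] at hx

/-- Multiplication of a Pauli operator by `X`, up to phase. -/
def flipX : Fin 4 → Fin 4 := ![1, 0, 3, 2]

lemma pauli_mul_pauliX (a : Fin 4) :
    ∃ k : ℕ, pauli a * pauliX = Complex.I ^ k • pauli (flipX a) := by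
  fin_cases a
  · exact ⟨0, by simp [pauli, flipX]⟩
  · exact ⟨0, by ext i j; fin_cases i <;> fin_cases j <;> simp [pauli, flipX, pauliX]⟩
  · exact ⟨3, by ext i j; fin_cases i <;> fin_cases j <;>
      simp [pauli, flipX, pauliX, pauliY, pauliZ, Complex.I_pow_three]⟩
  · exact ⟨1, by ext i j; fin_cases i <;> fin_cases j <;>
      simp [pauli, flipX, pauliX, pauliY, pauliZ]⟩

lemma pauli_mul_pauliX_pow (a : Fin 4) (m : ℕ) :
    ∃ k : ℕ, pauli a * pauliX ^ m = Complex.I ^ k • pauli (flipX^[m] a) := by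
  induction m with
  | zero => exact ⟨0, by simp⟩
  | succ m ih =>
    obtain ⟨k, hk⟩ := ih
    obtain ⟨l, hl⟩ := pauli_mul_pauliX (flipX^[m] a)
    refine ⟨k + l, ?_⟩
    rw [pow_succ, ← mul_assoc, hk, smul_mul_assoc, hl, smul_smul, ← pow_add,
      Function.iterate_succ_apply']

/-- The Pauli string with the given factors. -/
def pauliString {n : ℕ} (p : Fin n → Fin 4) : Op n := tensor (fun j => pauli (p j))

lemma pauliString_mul_self {n : ℕ} (p : Fin n → Fin 4) : pauliString p * pauliString p = 1 := by
  simp only [pauliString, tensor_mul, pauli_mul_self, tensor_one]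

lemma conjTranspose_pauliString {n : ℕ} (p : Fin n → Fin 4) :
    (pauliString p)ᴴ = pauliString p := by
  simp only [pauliString, conjTranspose_tensor, conjTranspose_pauli]

lemma pauliString_zero {n : ℕ} : pauliString (fun _ : Fin n => 0) = 1 := tensor_one

lemma onQubit_pauli {n : ℕ} (i : Fin n) (a : Fin 4) :
    onQubit i (pauli a) = pauliString (Function.update (fun _ => 0) i a) := by
  rw [onQubit, pauliString]
  congr 1
  ext1 k
  by_cases h : k = i
  · subst h; simp
  · simp [h, pauli]

lemma onQubit_pauliX {n : ℕ} (i : Fin n) :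
    onQubit i pauliX = pauliString (Function.update (fun _ => 0) i 1) := onQubit_pauli i 1

lemma onQubit_pauliZ {n : ℕ} (i : Fin n) :
    onQubit i pauliZ = pauliString (Function.update (fun _ => 0) i 3) := onQubit_pauli i 3

lemma onQubit_pauliX_mul {n : ℕ} (i : Fin n) (p : Fin n → Fin 4) :
    onQubit i pauliX * pauliString p = signX (p i) • (pauliString p * onQubit i pauliX) := by
  rw [pauliString, onQubit_mul_tensor, tensor_mul_onQubit, pauliX_mul_pauli, tensor_update_smul]

lemma onQubit_pauliZ_mul {n : ℕ} (i : Fin n) (p : Fin n → Fin 4) :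
    onQubit i pauliZ * pauliString p = signZ (p i) • (pauliString p * onQubit i pauliZ) := by
  rw [pauliString, onQubit_mul_tensor, tensor_mul_onQubit, pauliZ_mul_pauli, tensor_update_smul]

/-- Equality up to a power of `i`. -/
def PhaseEq {n : ℕ} (A B : Op n) : Prop := ∃ k : ℕ, A = Complex.I ^ k • B

lemma PhaseEq.refl {n : ℕ} (A : Op n) : PhaseEq A A := ⟨0, by simp⟩

lemma PhaseEq.of_eq {n : ℕ} {A B : Op n} (h : A = B) : PhaseEq A B := h ▸ PhaseEq.refl A

lemma PhaseEq.trans {n : ℕ} {A B C : Op n} (h : PhaseEq A B) (h' : PhaseEq B C) :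
    PhaseEq A C := by
  obtain ⟨k, rfl⟩ := h
  obtain ⟨l, rfl⟩ := h'
  exact ⟨k + l, by rw [smul_smul, pow_add]⟩

lemma PhaseEq.neg {n : ℕ} (A : Op n) : PhaseEq (-A) A := ⟨2, by simp⟩

lemma mem_pauliGroup_iff {n : ℕ} {A : Op n} :
    A ∈ pauliGroup n ↔ ∃ p, PhaseEq A (pauliString p) :=
  ⟨fun ⟨k, p, h⟩ => ⟨p, k, h⟩, fun ⟨p, k, h⟩ => ⟨k, p, h⟩⟩

lemma phaseEq_tensor {n : ℕ} (M : Fin n → Matrix (Fin 2) (Fin 2) ℂ) (p : Fin n → Fin 4)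
    (h : ∀ j, ∃ k : ℕ, M j = Complex.I ^ k • pauli (p j)) :
    PhaseEq (tensor M) (pauliString p) := by
  choose k hk using h
  refine ⟨∑ j, k j, ?_⟩
  rw [show M = fun j => Complex.I ^ k j • pauli (p j) from funext hk, tensor_smul,
    Finset.prod_pow_eq_pow_sum, pauliString]

/-- A Pauli operator that commutes with `X` and `Z` on a qubit is trivial there. -/
lemma eq_zero_of_commute {n : ℕ} {A : Op n} {p : Fin n → Fin 4} (h : PhaseEq A (pauliString p))
    {j : Fin n} (hx : Commute A (onQubit j pauliX)) (hz : Commute A (onQubit j pauliZ)) :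
    p j = 0 := by
  obtain ⟨k, rfl⟩ := h
  have hI : Complex.I ^ k ≠ 0 := pow_ne_zero _ Complex.I_ne_zero
  have key : ∀ (B : Op n) (s : ℂ), B * B = 1 → B * pauliString p = s • (pauliString p * B) →
      Commute (Complex.I ^ k • pauliString p) B → s = 1 := by
    intro B s hB h1 h2
    have h3 : pauliString p * B = B * pauliString p := by
      have := h2.eq
      rw [smul_mul_assoc, mul_smul_comm] at this
      exact smul_right_injective _ hI this
    rw [h1] at h3
    have h4 : (pauliString p * (pauliString p * B)) * B = 1 := by
      rw [← mul_assoc, pauliString_mul_self, one_mul, hB]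
    rw [h3, mul_smul_comm, ← mul_assoc (pauliString p), pauliString_mul_self, one_mul,
      smul_mul_assoc, hB] at h4
    have := congrFun (congrFun h4 (fun _ => 0)) (fun _ => 0)
    simpa using this
  refine eq_zero_of_signs _ (key _ _ ?_ (onQubit_pauliX_mul j p) hx)
    (key _ _ ?_ (onQubit_pauliZ_mul j p) hz)
  · rw [onQubit_pauliX, pauliString_mul_self]
  · rw [onQubit_pauliZ, pauliString_mul_self]

/-! ### Mølmer-Sørensen gates -/

/-- Products of powers of the operators `X_j`. -/
def xString {n : ℕ} (e : Fin n → ℕ) : Op n := tensor (fun l => pauliX ^ e l)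

lemma xString_add {n : ℕ} (e f : Fin n → ℕ) : xString (e + f) = xString e * xString f := by
  simp only [xString, tensor_mul, Pi.add_apply, pow_add]

lemma xString_zero {n : ℕ} : xString (0 : Fin n → ℕ) = 1 := by
  simp [xString, tensor_one]

lemma xString_single {n : ℕ} (j : Fin n) : xString (Pi.single j 1) = onQubit j pauliX := by
  rw [xString, onQubit]
  congr 1
  ext1 k
  by_cases h : k = j
  · subst h; simp
  · simp [h]

lemma phaseEq_pauliString_mul_xString {n : ℕ} (p : Fin n → Fin 4) (e : Fin n → ℕ) :
    PhaseEq (pauliString p * xString e) (pauliString (fun l => flipX^[e l] (p l))) := by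
  rw [pauliString, xString, tensor_mul]
  exact phaseEq_tensor _ _ fun j => pauli_mul_pauliX_pow _ _

lemma onQubit_pauliX_mul_self {n : ℕ} (j : Fin n) :
    onQubit j pauliX * onQubit j pauliX = 1 := by
  rw [onQubit_pauliX, pauliString_mul_self]

lemma commute_onQubit_same {n : ℕ} (j k : Fin n) (U : Matrix (Fin 2) (Fin 2) ℂ) :
    Commute (onQubit j U) (onQubit k U) := by
  by_cases h : j = k
  · subst h; exact Commute.refl _
  · exact commute_onQubit h _ _

open scoped Matrix.Norms.Operator in
-- By the spectral decomposition of an involution, (z, w) ↦ z(1 + P)/2 + w(1 - P)/2 is a continuous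
-- ring homomorphism from ℂ × ℂ. It carries the coordinatewise exponential of (iπ/2, -iπ/2), which
-- is (i, -i), to the exponential sought.
lemma exp_smul_of_mul_self_eq_one {n : ℕ} (P : Op n) (h : P * P = 1) :
    NormedSpace.exp ((Complex.I * (Real.pi / 2)) • P) = Complex.I • P := by
  let φ : ℂ × ℂ →+* Op n :=
    { toFun := fun z => ((z.1 + z.2) / 2) • (1 : Op n) + ((z.1 - z.2) / 2) • P
      map_one' := by simp
      map_zero' := by simp
      map_add' := fun z w => by
        simp only [Prod.fst_add, Prod.snd_add]
        module
      map_mul' := fun z w => by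
        simp only [Prod.fst_mul, Prod.snd_mul, add_mul, mul_add, smul_mul_smul_comm, one_mul,
          mul_one, h]
        module }
  have hφ : Continuous φ := by
    change Continuous fun z : ℂ × ℂ => ((z.1 + z.2) / 2) • (1 : Op n) + ((z.1 - z.2) / 2) • P
    fun_prop
  have h1 := NormedSpace.map_exp φ hφ
    (Complex.I * (Real.pi / 2), -(Complex.I * (Real.pi / 2)))
  have h2 : ∀ t : ℂ, φ (t, -t) = t • P := fun t => by
    change ((t + -t) / 2) • (1 : Op n) + ((t - -t) / 2) • P = t • P
    module
  have h3 : NormedSpace.exp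
      ((Complex.I * (Real.pi / 2), -(Complex.I * (Real.pi / 2))) : ℂ × ℂ)
      = (Complex.I, -Complex.I) := by
    have e1 : Complex.exp (Complex.I * (Real.pi / 2)) = Complex.I := by
      rw [mul_comm, Complex.exp_pi_div_two_mul_I]
    ext1
    · rw [Prod.fst_exp, ← Complex.exp_eq_exp_ℂ, e1]
    · rw [Prod.snd_exp, ← Complex.exp_eq_exp_ℂ, Complex.exp_neg, e1, Complex.inv_I]
  rw [h3, h2, h2] at h1
  exact h1.symm

/-- The summands commute and are involutions, so the exponential splits into factors i X_j X_k. -/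
lemma exp_sum_onQubit_pauliX {n : ℕ} (T : Finset (Fin n × Fin n)) :
    NormedSpace.exp ((Complex.I * (Real.pi / 2)) •
        ∑ t ∈ T, onQubit t.1 pauliX * onQubit t.2 pauliX)
      = Complex.I ^ T.card • xString (∑ t ∈ T, (Pi.single t.1 1 + Pi.single t.2 1)) := by
  induction T using Finset.induction_on with
  | empty => simp [xString_zero]
  | insert t T ht ih =>
    have hc : ∀ s : Fin n × Fin n, Commute (onQubit t.1 pauliX * onQubit t.2 pauliX)
        (onQubit s.1 pauliX * onQubit s.2 pauliX) := fun s =>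
      ((commute_onQubit_same _ _ _).mul_right (commute_onQubit_same _ _ _)).mul_left
        ((commute_onQubit_same _ _ _).mul_right (commute_onQubit_same _ _ _))
    have hsq : (onQubit t.1 pauliX * onQubit t.2 pauliX) *
        (onQubit t.1 pauliX * onQubit t.2 pauliX) = 1 := by
      rw [(commute_onQubit_same t.2 t.1 pauliX).mul_mul_mul_comm, onQubit_pauliX_mul_self,
        onQubit_pauliX_mul_self, one_mul]
    rw [Finset.sum_insert ht, Finset.sum_insert ht, smul_add, Matrix.exp_add_of_commute, ih,
      exp_smul_of_mul_self_eq_one _ hsq, xString_add, xString_add, xString_single, xString_single,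
      Finset.card_insert_of_notMem ht, smul_mul_smul_comm, pow_succ']
    exact ((Commute.sum_right _ _ _ fun s _ => hc s).smul_right _).smul_left _

/-- The sum of the operators `X_j` over a set of qubits. -/
def xSum {n : ℕ} (S : Finset (Fin n)) : Op n := ∑ j ∈ S, onQubit j pauliX

/-- The Ising Hamiltonian of a Mølmer-Sørensen gate. -/
def ising {n : ℕ} (S : Finset (Fin n)) : Op n :=
  ∑ p ∈ S.offDiag, onQubit p.1 pauliX * onQubit p.2 pauliX

/-- Completing the square: the diagonal terms are X_j² = 1. The Hamiltonian thus depends only on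
`xSum`, whose behaviour under a Pauli string is a matter of signs. -/
lemma ising_eq {n : ℕ} (S : Finset (Fin n)) :
    ising S = xSum S * xSum S - (S.card : ℂ) • 1 := by
  rw [ising, eq_sub_iff_add_eq, xSum, Finset.sum_mul_sum, ← Finset.sum_product',
    ← Finset.diag_union_offDiag, Finset.sum_union (Finset.disjoint_diag_offDiag S), add_comm]
  congr 1
  rw [Finset.sum_diag]
  simp [onQubit_pauliX_mul_self, Nat.cast_smul_eq_nsmul]

lemma GMS_eq {n : ℕ} (S : Finset (Fin n)) (α : ℝ) :
    GMS S α = NormedSpace.exp ((-Complex.I * ((α : ℂ) / 4)) • ising S) := rfl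

lemma GMS_mul_GMS_neg {n : ℕ} (S : Finset (Fin n)) (α : ℝ) : GMS S α * GMS S (-α) = 1 := by
  rw [GMS_eq, GMS_eq, ← Matrix.exp_add_of_commute, ← add_smul]
  · rw [show -Complex.I * ((α : ℂ) / 4) + -Complex.I * (((-α : ℝ) : ℂ) / 4) = 0 by
      push_cast; ring, zero_smul, NormedSpace.exp_zero]
  · exact ((Commute.refl _).smul_left _).smul_right _

lemma conjTranspose_xSum {n : ℕ} (S : Finset (Fin n)) : (xSum S)ᴴ = xSum S := by
  simp only [xSum, Matrix.conjTranspose_sum, onQubit_pauliX, conjTranspose_pauliString]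

lemma conjTranspose_GMS {n : ℕ} (S : Finset (Fin n)) (α : ℝ) : (GMS S α)ᴴ = GMS S (-α) := by
  rw [GMS_eq, GMS_eq, ← Matrix.exp_conjTranspose, Matrix.conjTranspose_smul, ising_eq,
    Matrix.conjTranspose_sub, Matrix.conjTranspose_mul, conjTranspose_xSum]
  congr 2
  · simp [neg_div]
  · simp

lemma GMS_mem_unitaryGroup {n : ℕ} (S : Finset (Fin n)) (α : ℝ) :
    GMS S α ∈ Matrix.unitaryGroup (Fin n → Fin 2) ℂ := by
  rw [Matrix.mem_unitaryGroup_iff, Matrix.star_eq_conjTranspose, conjTranspose_GMS,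
    GMS_mul_GMS_neg]

lemma GMS_eq_one {n : ℕ} (S : Finset (Fin n)) (α : ℝ) (h : S.card ≤ 1) : GMS S α = 1 := by
  have : S.offDiag = ∅ := by
    refine Finset.eq_empty_of_forall_notMem fun p hp => ?_
    rw [Finset.mem_offDiag] at hp
    exact hp.2.2 (Finset.card_le_one.mp h _ hp.1 _ hp.2.1)
  simp [GMS, this, NormedSpace.exp_zero]

lemma commute_GMS {n : ℕ} (S : Finset (Fin n)) (α : ℝ) (B : Op n)
    (h : ∀ j ∈ S, Commute (onQubit j pauliX) B) : Commute (GMS S α) B := by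
  apply Commute.exp_left
  refine (Commute.sum_left _ _ _ fun p hp => ?_).smul_left _
  rw [Finset.mem_offDiag] at hp
  exact (h _ hp.1).mul_left (h _ hp.2.1)

/-- The conjugate of a Pauli string by `GMS_S(π/2)`. -/
lemma GMS_conj_pauliString {n : ℕ} (S : Finset (Fin n)) (p : Fin n → Fin 4) :
    PhaseEq (GMS S (Real.pi / 2) * pauliString p * (GMS S (Real.pi / 2))ᴴ)
      (pauliString p * xString (∑ t ∈ S.filter (fun j => signX (p j) ≠ 1) ×ˢ
        S.filter (fun j => signX (p j) = 1), (Pi.single t.1 1 + Pi.single t.2 1))) := by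
  set U := pauliString p with hU
  set N := S.filter (fun j => signX (p j) ≠ 1) with hN
  set R := S.filter (fun j => signX (p j) = 1) with hR
  have hS : xSum S = xSum N + xSum R := by
    rw [xSum, xSum, xSum, add_comm, hN, hR, Finset.sum_filter_add_sum_filter_not]
  have ha : xSum N * U = -(U * xSum N) := by
    rw [xSum, Finset.sum_mul, Finset.mul_sum, ← Finset.sum_neg_distrib]
    refine Finset.sum_congr rfl fun j hj => ?_
    have : signX (p j) = -1 := by
      rcases mul_self_eq_one_iff.mp (signX_mul_self (p j)) with h | h
      · exact absurd h (Finset.mem_filter.mp hj).2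
      · exact h
    rw [hU, onQubit_pauliX_mul, this, neg_one_smul]
  have hb : xSum R * U = U * xSum R := by
    rw [xSum, Finset.sum_mul, Finset.mul_sum]
    refine Finset.sum_congr rfl fun j hj => ?_
    rw [hU, onQubit_pauliX_mul, (Finset.mem_filter.mp hj).2, one_smul]
  have hab : Commute (xSum N) (xSum R) :=
    Commute.sum_left _ _ _ fun _ _ => Commute.sum_right _ _ _ fun _ _ =>
      commute_onQubit_same _ _ _
  set a := xSum N with ha'
  set b := xSum R with hb'
  -- The string U reverses the sign of a and leaves b alone, so it conjugates the Hamiltonian, built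
  -- on (a + b)², into K, built on (b - a)².
  set K : Op n := (b - a) * (b - a) - (S.card : ℂ) • 1 with hK
  have hH : ising S = (a + b) * (a + b) - (S.card : ℂ) • 1 := by rw [ising_eq, hS]
  have hUU : U * U = 1 := pauliString_mul_self p
  have hinv : U⁻¹ = U := Matrix.inv_eq_right_inv hUU
  have hunit : IsUnit U := IsUnit.of_mul_eq_one _ hUU
  have hsU : (a + b) * U = U * (b - a) := by
    rw [add_mul, ha, hb, mul_sub]; abel
  have hHU : ising S = U * K * U⁻¹ := by
    have : ising S * U = U * K := by
      rw [hH, hK, sub_mul, mul_sub, mul_assoc, hsU, ← mul_assoc, hsU]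
      simp [mul_assoc]
    rw [← this, hinv, mul_assoc, hUU, mul_one]
  set c : ℂ := -Complex.I * (((Real.pi / 2 : ℝ) : ℂ) / 4) with hc
  have h1 : GMS S (Real.pi / 2) * U = U * NormedSpace.exp (c • K) := by
    have e1 : c • ising S = U * (c • K) * U⁻¹ := by
      rw [hHU, mul_smul_comm, smul_mul_assoc]
    rw [GMS_eq, ← hc, e1, Matrix.exp_conj _ _ hunit, hinv, mul_assoc, hUU, mul_one]
  have hKH : Commute K (ising S) := by
    have h0 : Commute (b - a) (a + b) :=
      ((hab.symm.add_right (Commute.refl _)).sub_left ((Commute.refl _).add_right hab))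
    have one_comm : ∀ B : Op n, Commute B ((S.card : ℂ) • (1 : Op n)) := fun B =>
      (Commute.one_right B).smul_right _
    rw [hH, hK]
    exact (((h0.mul_right h0).mul_left (h0.mul_right h0)).sub_left (one_comm _).symm).sub_right
      (one_comm _)
  have h2 : (GMS S (Real.pi / 2))ᴴ = NormedSpace.exp ((-c) • ising S) := by
    rw [conjTranspose_GMS, GMS_eq]
    congr 2
    rw [hc]; push_cast; ring
  -- With U moved to the left, U exp(cK) exp(-cH) remains, where H is `ising S`. Only the cross
  -- terms of the squares survive: K - H = -4ab. As c = -iπ/8, each pair receives the angle iπ/2, at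
  -- which the exponential is again a Pauli operator.
  have h3 : c • K + (-c) • ising S = (Complex.I * (Real.pi / 2)) • (a * b) := by
    have h4 : K - ising S = (-4 : ℂ) • (a * b) := by
      rw [hK, hH]
      simp only [sub_mul, mul_sub, add_mul, mul_add, hab.symm.eq]
      module
    rw [neg_smul, ← sub_eq_add_neg, ← smul_sub, h4, smul_smul, hc]
    congr 1
    push_cast; ring
  have h5 : a * b = ∑ t ∈ N ×ˢ R, onQubit t.1 pauliX * onQubit t.2 pauliX := by
    rw [ha', hb', xSum, xSum, Finset.sum_mul_sum, ← Finset.sum_product']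
  refine ⟨(N ×ˢ R).card, ?_⟩
  rw [h1, h2, mul_assoc, ← Matrix.exp_add_of_commute _ _ ((hKH.smul_left _).smul_right _), h3, h5,
    exp_sum_onQubit_pauliX, mul_smul_comm]

/-! ### Conjugation -/

/-- Conjugation of an operator. -/
def conj {n : ℕ} (D P : Op n) : Op n := D * P * Dᴴ

lemma conj_mul {n : ℕ} (D E P : Op n) : conj (D * E) P = conj D (conj E P) := by
  simp only [conj, Matrix.conjTranspose_mul, mul_assoc]

lemma conj_smul {n : ℕ} (D P : Op n) (c : ℂ) : conj D (c • P) = c • conj D P := by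
  simp only [conj, mul_smul_comm, smul_mul_assoc]

lemma one_conj {n : ℕ} (P : Op n) : conj 1 P = P := by simp [conj]

lemma conj_mul_right {n : ℕ} {D : Op n} (hD : D ∈ Matrix.unitaryGroup (Fin n → Fin 2) ℂ)
    (P Q : Op n) : conj D (P * Q) = conj D P * conj D Q := by
  have h : Dᴴ * D = 1 := Matrix.mem_unitaryGroup_iff'.mp hD
  calc D * (P * Q) * Dᴴ = D * P * 1 * Q * Dᴴ := by simp only [mul_assoc, one_mul]
    _ = D * P * Dᴴ * (D * Q * Dᴴ) := by rw [← h]; simp only [mul_assoc]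

lemma conj_one {n : ℕ} {D : Op n} (hD : D ∈ Matrix.unitaryGroup (Fin n → Fin 2) ℂ) :
    conj D 1 = 1 := by
  rw [conj, mul_one]; exact Matrix.mem_unitaryGroup_iff.mp hD

lemma conj_eq_of_commute {n : ℕ} {D P : Op n} (hD : D ∈ Matrix.unitaryGroup (Fin n → Fin 2) ℂ)
    (h : Commute D P) : conj D P = P := by
  rw [conj, h.eq, mul_assoc, ← Matrix.star_eq_conjTranspose, Matrix.mem_unitaryGroup_iff.mp hD,
    mul_one]

lemma commute_of_conj_eq {n : ℕ} {D P : Op n} (hD : D ∈ Matrix.unitaryGroup (Fin n → Fin 2) ℂ)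
    (h : conj D P = P) : Commute D P := by
  have h' : Dᴴ * D = 1 := Matrix.mem_unitaryGroup_iff'.mp hD
  calc D * P = D * P * (Dᴴ * D) := by rw [h', mul_one]
    _ = conj D P * D := by simp only [conj, mul_assoc]
    _ = P * D := by rw [h]

lemma PhaseEq.conj {n : ℕ} {P Q : Op n} (h : PhaseEq P Q) (D : Op n) :
    PhaseEq (conj D P) (conj D Q) := by
  obtain ⟨k, rfl⟩ := h
  exact ⟨k, conj_smul _ _ _⟩

/-! ### Circuits -/

lemma Circuit.op_append {n : ℕ} (c d : Circuit n) :
    Circuit.op (c ++ d) = Circuit.op d * Circuit.op c := by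
  induction c with
  | nil => simp [Circuit.op]
  | cons g c ih => simp only [List.cons_append, Circuit.op, ih, mul_assoc]

lemma Circuit.gmsCount_append {n : ℕ} (c d : Circuit n) :
    Circuit.gmsCount (c ++ d) = Circuit.gmsCount c + Circuit.gmsCount d := by
  simp [Circuit.gmsCount]

/-- The operator is implemented by a circuit with at most `m` Mølmer-Sørensen gates. -/
def Implementable {n : ℕ} (m : ℕ) (C : Op n) : Prop :=
  ∃ c : Circuit n, Circuit.op c = C ∧ Circuit.gmsCount c ≤ m

lemma Implementable.one {n : ℕ} : Implementable 0 (1 : Op n) :=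
  ⟨[], rfl, by simp [Circuit.gmsCount]⟩

lemma Implementable.mul {n m k : ℕ} {C D : Op n} (hC : Implementable m C)
    (hD : Implementable k D) : Implementable (m + k) (C * D) := by
  obtain ⟨c, rfl, hc⟩ := hC
  obtain ⟨d, rfl, hd⟩ := hD
  refine ⟨d ++ c, Circuit.op_append _ _, ?_⟩
  rw [Circuit.gmsCount_append]
  omega

lemma Implementable.mono {n m k : ℕ} {C : Op n} (hC : Implementable m C) (h : m ≤ k) :
    Implementable k C := by
  obtain ⟨c, h1, h2⟩ := hC
  exact ⟨c, h1, h2.trans h⟩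

lemma Implementable.onQubit {n : ℕ} (i : Fin n) {U : Matrix (Fin 2) (Fin 2) ℂ}
    (hU : IsSingleQubitClifford U) : Implementable 0 (onQubit i U) :=
  ⟨[Gate.localClifford i U hU], by simp [Circuit.op, Gate.op],
    by simp [Circuit.gmsCount, Gate.cost]⟩

lemma Implementable.gms {n : ℕ} (S : Finset (Fin n)) (α : ℝ) : Implementable 1 (GMS S α) :=
  ⟨[Gate.gms S α], by simp [Circuit.op, Gate.op], by simp [Circuit.gmsCount, Gate.cost]⟩

lemma Implementable.tensor {n : ℕ} {U : Fin n → Matrix (Fin 2) (Fin 2) ℂ}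
    (hU : ∀ j, IsSingleQubitClifford (U j)) : Implementable 0 (tensor U) := by
  have : ∀ S : Finset (Fin n),
      Implementable 0 (Qubits.tensor fun j => if j ∈ S then U j else 1) := by
    intro S
    induction S using Finset.induction_on with
    | empty => simpa [tensor_one] using Implementable.one
    | insert j S hj ih =>
      have := (Implementable.onQubit j (hU j)).mul ih
      rw [onQubit_mul_tensor] at this
      convert this using 2
      ext1 k
      by_cases h : k = j
      · subst h; simp [hj]
      · simp [h]
  simpa using this Finset.univ

/-! ### Operators supported on a set of qubits -/

/-- A unitary operator on the qubits in `A` that maps Pauli operators to Pauli operators. -/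
structure IsCliffordOn {n : ℕ} (A : Finset (Fin n)) (D : Op n) : Prop where
  unitary : D ∈ Matrix.unitaryGroup (Fin n → Fin 2) ℂ
  conj_mem : ∀ p, ∃ q, PhaseEq (conj D (pauliString p)) (pauliString q)
  commute : ∀ j ∉ A, ∀ M, Commute D (onQubit j M)

/-- A Clifford operator on the qubits in `A` whose adjoint is implemented by a circuit with at most
`m` Mølmer-Sørensen gates. -/
structure CliffordOn {n : ℕ} (A : Finset (Fin n)) (m : ℕ) (D : Op n) : Prop
    extends IsCliffordOn A D where
  impl : Implementable m Dᴴ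

lemma IsCliffordOn.mul {n : ℕ} {A : Finset (Fin n)} {D E : Op n} (hD : IsCliffordOn A D)
    (hE : IsCliffordOn A E) : IsCliffordOn A (D * E) where
  unitary := mul_mem hD.unitary hE.unitary
  conj_mem p := by
    obtain ⟨q, hq⟩ := hE.conj_mem p
    obtain ⟨r, hr⟩ := hD.conj_mem q
    exact ⟨r, by rw [conj_mul]; exact (hq.conj D).trans hr⟩
  commute j hj M := (hD.commute j hj M).mul_left (hE.commute j hj M)

lemma CliffordOn.one {n : ℕ} (A : Finset (Fin n)) : CliffordOn A 0 1 where
  unitary := one_mem _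
  conj_mem p := ⟨p, PhaseEq.of_eq (one_conj _)⟩
  commute _ _ _ := Commute.one_left _
  impl := by simpa using Implementable.one

lemma CliffordOn.mul {n : ℕ} {A : Finset (Fin n)} {m k : ℕ} {D E : Op n} (hD : CliffordOn A m D)
    (hE : CliffordOn A k E) : CliffordOn A (m + k) (D * E) where
  toIsCliffordOn := hD.toIsCliffordOn.mul hE.toIsCliffordOn
  impl := by
    rw [Matrix.conjTranspose_mul, add_comm]
    exact hE.impl.mul hD.impl

lemma CliffordOn.mono {n : ℕ} {A : Finset (Fin n)} {m k : ℕ} {D : Op n} (hD : CliffordOn A m D)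
    (h : m ≤ k) : CliffordOn A k D where
  toIsCliffordOn := hD.toIsCliffordOn
  impl := hD.impl.mono h

/-- A gate with at most one target is the identity, so on a single qubit the cost is 0. The
truncated subtraction records this, also for empty `A`. -/
lemma CliffordOn.gms {n : ℕ} {A S : Finset (Fin n)} (hS : S ⊆ A) :
    CliffordOn A (min 1 (A.card - 1)) (GMS S (Real.pi / 2)) where
  unitary := GMS_mem_unitaryGroup _ _
  conj_mem p := ⟨_, (GMS_conj_pauliString S p).trans (phaseEq_pauliString_mul_xString _ _)⟩
  commute j hj M := commute_GMS _ _ _ fun k hk =>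
    commute_onQubit (fun h : k = j => hj (h ▸ hS hk)) _ _
  impl := by
    rw [conjTranspose_GMS]
    by_cases h : S.card ≤ 1
    · rw [GMS_eq_one _ _ h]
      exact Implementable.one.mono (Nat.zero_le _)
    · have := Finset.card_le_card hS
      exact (Implementable.gms S _).mono (by omega)

/-! ### Local Clifford gates -/

/-- Hermitian involutions that permute the Pauli operators up to phase. -/
structure IsCliffordInvolution (U : Matrix (Fin 2) (Fin 2) ℂ) : Prop where
  hermitian : Uᴴ = U
  mul_self : U * U = 1
  conj_pauli : ∀ a, ∃ (b : Fin 4) (k : ℕ), U * pauli a * U = Complex.I ^ k • pauli b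

lemma IsCliffordInvolution.one : IsCliffordInvolution 1 where
  hermitian := by simp
  mul_self := by simp
  conj_pauli a := ⟨a, 0, by simp⟩

lemma pauli_mul_pauli_mul_pauli (a b : Fin 4) :
    ∃ k : ℕ, pauli a * pauli b * pauli a = Complex.I ^ k • pauli b := by
  suffices h : pauli a * pauli b * pauli a = pauli b ∨ pauli a * pauli b * pauli a = -pauli b by
    rcases h with h | h
    · exact ⟨0, by simp [h]⟩
    · exact ⟨2, by simp [h]⟩
  fin_cases a <;> fin_cases b <;>
    simp [pauli, pauliX, pauliY, pauliZ, Matrix.one_fin_two]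

lemma IsCliffordInvolution.pauli (a : Fin 4) : IsCliffordInvolution (pauli a) where
  hermitian := conjTranspose_pauli a
  mul_self := pauli_mul_self a
  conj_pauli b := ⟨b, pauli_mul_pauli_mul_pauli a b⟩

/-- The reflection that exchanges two Pauli operators. -/
noncomputable def exchange (a b : Fin 4) : Matrix (Fin 2) (Fin 2) ℂ :=
  if a = b then 1 else ((Real.sqrt 2 : ℂ)⁻¹) • (pauli a + pauli b)

lemma sqrt_two_inv_mul_self : ((Real.sqrt 2 : ℂ)⁻¹) * ((Real.sqrt 2 : ℂ)⁻¹) = 2⁻¹ := by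
  rw [← mul_inv, ← Complex.ofReal_mul, Real.mul_self_sqrt (by norm_num)]
  simp

lemma pauli_anticommute {a b : Fin 4} (ha : a ≠ 0) (hb : b ≠ 0) (h : a ≠ b) :
    pauli b * pauli a = -(pauli a * pauli b) := by
  fin_cases a <;> fin_cases b <;> first
    | exact absurd rfl ha
    | exact absurd rfl hb
    | exact absurd rfl h
    | (ext i j; fin_cases i <;> fin_cases j <;> simp [pauli, pauliX, pauliY, pauliZ])

/-- Distinct nontrivial Paulis anticommute, so (P_a + P_b)/√2 is a reflection swapping them. The
hypothesis excludes an exchange of the identity with something else. -/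
lemma exchange_conj_left {a b : Fin 4} (h : a = 0 ↔ b = 0) :
    exchange a b * pauli a * exchange a b = pauli b := by
  by_cases hab : a = b
  · simp [exchange, hab]
  have hb : b ≠ 0 := fun hb => hab ((h.mpr hb).trans hb.symm)
  have ha : a ≠ 0 := fun ha => hb (h.mp ha)
  have e1 := pauli_anticommute ha hb hab
  rw [exchange, if_neg hab, smul_mul_assoc, smul_mul_smul_comm, sqrt_two_inv_mul_self]
  have e2 : (pauli a + pauli b) * pauli a * (pauli a + pauli b)
      = (2 : ℂ) • pauli b := by
    have e3 : pauli a * pauli b * pauli a = -pauli b := by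
      rw [mul_assoc, e1, mul_neg, ← mul_assoc, pauli_mul_self, one_mul]
    have e4 : pauli a * pauli b * pauli b = pauli a := by
      rw [mul_assoc, pauli_mul_self, mul_one]
    rw [add_mul, pauli_mul_self, e1, mul_add, add_mul, add_mul, one_mul, one_mul, neg_mul, neg_mul,
      e3, e4]
    module
  rw [e2, smul_smul]
  norm_num

lemma exchange_mul_self {a b : Fin 4} (h : a = 0 ↔ b = 0) :
    exchange a b * exchange a b = 1 := by
  by_cases hab : a = b
  · simp [exchange, hab]
  have hb : b ≠ 0 := fun hb => hab ((h.mpr hb).trans hb.symm)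
  have ha : a ≠ 0 := fun ha => hb (h.mp ha)
  rw [exchange, if_neg hab, smul_mul_smul_comm, sqrt_two_inv_mul_self]
  have e2 : (pauli a + pauli b) * (pauli a + pauli b) = (2 : ℂ) • 1 := by
    simp only [add_mul, mul_add, pauli_anticommute ha hb hab, pauli_mul_self]
    module
  rw [e2, smul_smul]
  norm_num

lemma exchange_conj_third {a b c : Fin 4} (ha : a ≠ 0) (hb : b ≠ 0) (hc : c ≠ 0) (hab : a ≠ b)
    (hca : c ≠ a) (hcb : c ≠ b) : exchange a b * pauli c * exchange a b = -pauli c := by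
  have h1 : exchange a b * pauli c = -(pauli c * exchange a b) := by
    rw [exchange, if_neg hab, smul_mul_assoc, mul_smul_comm, add_mul, mul_add,
      pauli_anticommute hc ha hca, pauli_anticommute hc hb hcb]
    module
  rw [h1, neg_mul, mul_assoc, exchange_mul_self (by simp [ha, hb]), mul_one]

lemma exchange_comm (a b : Fin 4) : exchange a b = exchange b a := by
  simp only [exchange, eq_comm (a := a) (b := b), add_comm (pauli a)]

lemma IsCliffordInvolution.exchange {a b : Fin 4} (h : a = 0 ↔ b = 0) :
    IsCliffordInvolution (exchange a b) where
  hermitian := by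
    by_cases hab : a = b
    · simp [Qubits.exchange, hab]
    · simp [Qubits.exchange, hab, Matrix.conjTranspose_smul, conjTranspose_pauli]
  mul_self := exchange_mul_self h
  conj_pauli c := by
    by_cases hab : a = b
    · exact ⟨c, 0, by simp [Qubits.exchange, hab]⟩
    have hb : b ≠ 0 := fun hb => hab ((h.mpr hb).trans hb.symm)
    have ha : a ≠ 0 := fun ha => hb (h.mp ha)
    by_cases hc : c = 0
    · exact ⟨0, 0, by subst hc; simp [Qubits.pauli, exchange_mul_self h]⟩
    by_cases hca : c = a
    · exact ⟨b, 0, by rw [hca, exchange_conj_left h]; simp⟩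
    by_cases hcb : c = b
    · exact ⟨a, 0, by rw [hcb, exchange_comm, exchange_conj_left h.symm]; simp⟩
    exact ⟨c, 2, by rw [exchange_conj_third ha hb hc hab hca hcb]; simp⟩

lemma conj_tensor {n : ℕ} {U : Fin n → Matrix (Fin 2) (Fin 2) ℂ}
    (hU : ∀ j, IsCliffordInvolution (U j)) (M : Fin n → Matrix (Fin 2) (Fin 2) ℂ) :
    conj (tensor U) (tensor M) = tensor (fun j => U j * M j * U j) := by
  rw [conj, conjTranspose_tensor, tensor_mul, tensor_mul]
  simp only [(hU _).hermitian]

lemma tensor_mul_self_of_involution {n : ℕ} {U : Fin n → Matrix (Fin 2) (Fin 2) ℂ}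
    (hU : ∀ j, IsCliffordInvolution (U j)) : tensor U * tensor U = 1 := by
  simp only [tensor_mul, (hU _).mul_self, tensor_one]

lemma conjTranspose_tensor_of_involution {n : ℕ} {U : Fin n → Matrix (Fin 2) (Fin 2) ℂ}
    (hU : ∀ j, IsCliffordInvolution (U j)) : (tensor U)ᴴ = tensor U := by
  simp only [conjTranspose_tensor, (hU _).hermitian]

lemma conj_tensor_pauliString {n : ℕ} {U : Fin n → Matrix (Fin 2) (Fin 2) ℂ}
    (hU : ∀ j, IsCliffordInvolution (U j)) (p : Fin n → Fin 4) :
    ∃ q, PhaseEq (conj (tensor U) (pauliString p)) (pauliString q) := by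
  choose f hf using fun j => (hU j).conj_pauli (p j)
  exact ⟨f, by rw [pauliString, conj_tensor hU]; exact phaseEq_tensor _ _ hf⟩

/-- Conjugating twice is the identity, so preserving the Pauli group in one direction gives the
equivalence. -/
lemma IsCliffordInvolution.isSingleQubitClifford {U : Matrix (Fin 2) (Fin 2) ℂ}
    (hU : IsCliffordInvolution U) : IsSingleQubitClifford U := by
  have hU' : ∀ _ : Fin 1, IsCliffordInvolution U := fun _ => hU
  have hsq := tensor_mul_self_of_involution hU'
  have hH := conjTranspose_tensor_of_involution hU'
  set T : Op 1 := tensor fun _ => U with hT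
  have key : ∀ A ∈ pauliGroup 1, T * A * Tᴴ ∈ pauliGroup 1 := by
    intro A hA
    obtain ⟨p, hp⟩ := mem_pauliGroup_iff.mp hA
    obtain ⟨q, hq⟩ := conj_tensor_pauliString hU' p
    exact mem_pauliGroup_iff.mpr ⟨q, (hp.conj T).trans hq⟩
  refine ⟨?_, fun A => ⟨fun h => ?_, key A⟩⟩
  · rw [Matrix.mem_unitaryGroup_iff, Matrix.star_eq_conjTranspose, ← hT, hH, hsq]
  · have := key _ h
    rw [← hT, hH] at this
    rwa [← mul_assoc, ← mul_assoc, hsq, one_mul, mul_assoc, hsq, mul_one] at this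

lemma CliffordOn.tensor {n : ℕ} {A : Finset (Fin n)} {U : Fin n → Matrix (Fin 2) (Fin 2) ℂ}
    (hU : ∀ j, IsCliffordInvolution (U j)) (hA : ∀ j ∉ A, U j = 1) :
    CliffordOn A 0 (tensor U) where
  unitary := by
    rw [Matrix.mem_unitaryGroup_iff, Matrix.star_eq_conjTranspose,
      conjTranspose_tensor_of_involution hU, tensor_mul_self_of_involution hU]
  conj_mem := conj_tensor_pauliString hU
  commute j hj M := commute_tensor_onQubit _ _ _ (by rw [hA j hj]; exact Commute.one_left _)
  impl := by
    rw [conjTranspose_tensor_of_involution hU]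
    exact Implementable.tensor fun j => (hU j).isSingleQubitClifford

lemma isSingleQubitClifford_smul_one {c : ℂ} (hc : c * star c = 1) :
    IsSingleQubitClifford (c • 1) := by
  have h1 : tensor (fun _ : Fin 1 => c • (1 : Matrix (Fin 2) (Fin 2) ℂ)) = c • 1 := by
    rw [tensor_smul (fun _ => c), tensor_one]; simp
  rw [IsSingleQubitClifford, h1]
  refine ⟨?_, fun A => ?_⟩
  · rw [Matrix.mem_unitaryGroup_iff, Matrix.star_eq_conjTranspose, Matrix.conjTranspose_smul,
      smul_mul_smul_comm, hc]
    simp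
  · rw [Matrix.conjTranspose_smul, smul_mul_assoc, smul_mul_smul_comm, hc]
    simp

/-! ### Operators commuting with Pauli operators -/

lemma onQubit_apply {n : ℕ} (j : Fin n) (U : Matrix (Fin 2) (Fin 2) ℂ) (x y : Fin n → Fin 2) :
    onQubit j U x y
      = U (x j) (y j) * ∏ k ∈ Finset.univ.erase j, (1 : Matrix (Fin 2) (Fin 2) ℂ) (x k) (y k) := by
  rw [onQubit, tensor, ← Finset.mul_prod_erase _ _ (Finset.mem_univ j)]
  congr 1
  · simp
  · refine Finset.prod_congr rfl fun k hk => ?_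
    rw [Function.update_of_ne (Finset.ne_of_mem_erase hk)]

lemma onQubit_add {n : ℕ} (j : Fin n) (U V : Matrix (Fin 2) (Fin 2) ℂ) :
    onQubit j (U + V) = onQubit j U + onQubit j V := by
  ext x y
  simp only [Matrix.add_apply, onQubit_apply, add_mul]

/-- The matrices 1, Z, X and XZ span all 2 × 2 matrices. -/
lemma commute_onQubit_of_pauli {n : ℕ} {D : Op n} {j : Fin n}
    (hX : Commute D (onQubit j pauliX)) (hZ : Commute D (onQubit j pauliZ))
    (U : Matrix (Fin 2) (Fin 2) ℂ) : Commute D (onQubit j U) := by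
  have hU : U = ((U 0 0 + U 1 1) / 2) • 1 + ((U 0 0 - U 1 1) / 2) • pauliZ
      + ((U 0 1 + U 1 0) / 2) • pauliX + ((U 1 0 - U 0 1) / 2) • (pauliX * pauliZ) := by
    ext a b
    fin_cases a <;> fin_cases b <;> simp [pauliX, pauliZ] <;> ring
  rw [hU, onQubit_add, onQubit_add, onQubit_add, onQubit_smul, onQubit_smul, onQubit_smul,
    onQubit_smul, onQubit_one, ← onQubit_mul]
  exact ((((Commute.one_right D).smul_right _).add_right (hZ.smul_right _)).add_right
    (hX.smul_right _)).add_right ((hX.mul_right hZ).smul_right _)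

lemma commute_tensor {n : ℕ} {D : Op n} (h : ∀ j M, Commute D (onQubit j M))
    (M : Fin n → Matrix (Fin 2) (Fin 2) ℂ) : Commute D (tensor M) := by
  have : ∀ S : Finset (Fin n), Commute D (tensor fun j => if j ∈ S then M j else 1) := by
    intro S
    induction S using Finset.induction_on with
    | empty => simp [tensor_one]
    | insert j S hj ih =>
      have := (h j (M j)).mul_right ih
      rw [onQubit_mul_tensor] at this
      have e : (fun k => if k ∈ insert j S then M k else 1)
          = Function.update (fun k => if k ∈ S then M k else 1) j
            (M j * if j ∈ S then M j else 1) := by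
        ext1 k
        by_cases h : k = j
        · subst h; simp [hj]
        · simp [h]
      rw [e]
      exact this
  simpa using this Finset.univ

lemma tensor_single {n : ℕ} (x y : Fin n → Fin 2) :
    tensor (fun j => Matrix.single (x j) (y j) (1 : ℂ)) = Matrix.single x y 1 := by
  ext u v
  by_cases h : x = u ∧ y = v
  · obtain ⟨rfl, rfl⟩ := h
    simp [tensor]
  · rw [Matrix.single_apply_of_ne _ _ _ _ _ h]
    have : ∃ k, ¬(x k = u k ∧ y k = v k) := by
      by_contra! h'
      exact h ⟨funext fun k => (h' k).1, funext fun k => (h' k).2⟩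
    obtain ⟨k, hk⟩ := this
    exact Finset.prod_eq_zero (Finset.mem_univ k) (Matrix.single_apply_of_ne _ _ _ _ _ hk)

/-- Matrix units are tensor products of one-qubit matrix units, so such an operator commutes with
every matrix unit. -/
lemma exists_eq_smul_one {n : ℕ} {D : Op n} (h : ∀ j M, Commute D (onQubit j M)) :
    ∃ c : ℂ, D = c • 1 := by
  obtain ⟨c, hc⟩ := Matrix.mem_range_scalar_of_commute_single (M := D) fun x y _ => by
    change Commute (Matrix.single x y 1) D
    rw [← tensor_single]
    exact (commute_tensor h _).symm
  exact ⟨c, by rw [← hc, Matrix.scalar_apply, Matrix.smul_one_eq_diagonal]⟩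

lemma commute_conj {n : ℕ} {D P B : Op n} (hD : D ∈ Matrix.unitaryGroup (Fin n → Fin 2) ℂ)
    (h : Commute D B) (h' : Commute P B) : Commute (conj D P) B := by
  have hB := conj_eq_of_commute hD h
  rw [Commute, SemiconjBy]
  nth_rewrite 1 [← hB]
  nth_rewrite 2 [← hB]
  rw [← conj_mul_right hD, ← conj_mul_right hD, h'.eq]

/-- This excludes two degenerate cases in `exists_map_commute`: a trivial image of X_i, and an image
of Z_i that commutes with X at i. -/
lemma not_commute_conj_pauli {n : ℕ} {D : Op n}
    (hD : D ∈ Matrix.unitaryGroup (Fin n → Fin 2) ℂ) (i : Fin n) :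
    ¬Commute (conj D (onQubit i pauliX)) (conj D (onQubit i pauliZ)) := by
  intro h
  have h' : Dᴴ * D = 1 := Matrix.mem_unitaryGroup_iff'.mp hD
  have hinj : ∀ P : Op n, Dᴴ * conj D P * D = P := fun P => by
    rw [conj, ← mul_assoc, ← mul_assoc, h', one_mul, mul_assoc, h', mul_one]
  have h1 : Commute (onQubit i pauliX) (onQubit i pauliZ) := by
    have := h.eq
    rw [← conj_mul_right hD, ← conj_mul_right hD] at this
    rw [Commute, SemiconjBy, ← hinj (onQubit i pauliX * _), this, hinj]
  have := eq_zero_of_commute (PhaseEq.of_eq (onQubit_pauliX i)) (Commute.refl _) h1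
  simp at this

/-- The image of a Pauli string supported on `A` is supported on `A`. -/
lemma IsCliffordOn.eq_zero {n : ℕ} {A : Finset (Fin n)} {D : Op n} (hD : IsCliffordOn A D)
    {i : Fin n} (hi : i ∈ A) {U : Matrix (Fin 2) (Fin 2) ℂ} {p : Fin n → Fin 4}
    (hp : PhaseEq (conj D (onQubit i U)) (pauliString p)) {j : Fin n} (hj : j ∉ A) : p j = 0 := by
  have hij : i ≠ j := fun h => hj (h ▸ hi)
  exact eq_zero_of_commute hp
    (commute_conj hD.unitary (hD.commute j hj _) (commute_onQubit hij _ _))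
    (commute_conj hD.unitary (hD.commute j hj _) (commute_onQubit hij _ _))

/-! ### Reduction of a Pauli string to one qubit -/

/-- Exchange the two Paulis at each qubit. In the last clause both factors at i lie in {Y, Z}, so
the exchange there is trivial or swaps Y and Z, and sends X to ±X. -/
lemma exists_local_map {n : ℕ} {A : Finset (Fin n)} {p q : Fin n → Fin 4}
    (h : ∀ j, p j = 0 ↔ q j = 0) (hp : ∀ j ∉ A, p j = 0) :
    ∃ D, CliffordOn A 0 D ∧ conj D (pauliString p) = pauliString q ∧
      ∀ i, signX (p i) ≠ 1 → signX (q i) ≠ 1 →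
        PhaseEq (conj D (onQubit i pauliX)) (onQubit i pauliX) := by
  have hU : ∀ j, IsCliffordInvolution (exchange (p j) (q j)) := fun j => .exchange (h j)
  refine ⟨tensor fun j => exchange (p j) (q j), CliffordOn.tensor hU fun j hj => ?_, ?_,
    fun i hpi hqi => ?_⟩
  · rw [hp j hj, (h j).mp (hp j hj), exchange, if_pos rfl]
  · rw [pauliString, conj_tensor hU]
    simp only [exchange_conj_left (h _), pauliString]
  · have h1 : exchange (p i) (q i) * pauliX * exchange (p i) (q i) = pauliX ∨
        exchange (p i) (q i) * pauliX * exchange (p i) (q i) = -pauliX := by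
      by_cases hpq : p i = q i
      · simp [exchange, hpq]
      · right
        rw [signX_ne_one_iff] at hpi hqi
        rcases hpi with hpi | hpi <;> rcases hqi with hqi | hqi <;> rw [hpi, hqi] at hpq ⊢
        · exact absurd rfl hpq
        · exact exchange_conj_third (c := 1) (by decide) (by decide) (by decide) (by decide)
            (by decide) (by decide)
        · exact exchange_conj_third (c := 1) (by decide) (by decide) (by decide) (by decide)
            (by decide) (by decide)
        · exact absurd rfl hpq
    have h2 : conj (tensor fun j => exchange (p j) (q j)) (onQubit i pauliX)
        = onQubit i (exchange (p i) (q i) * pauliX * exchange (p i) (q i)) := by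
      rw [onQubit, conj_tensor hU, onQubit]
      congr 1
      ext1 k
      by_cases hk : k = i
      · subst hk; simp
      · simp [hk, exchange_mul_self (h k)]
    rw [h2]
    rcases h1 with h1 | h1
    · rw [h1]; exact PhaseEq.refl _
    · rw [h1, ← neg_one_smul ℂ, onQubit_smul, neg_one_smul]; exact PhaseEq.neg _

lemma signX_flipX (a : Fin 4) : signX (flipX a) = signX a := by
  fin_cases a <;> simp [signX, flipX]

lemma signX_iterate_flipX (a : Fin 4) (m : ℕ) : signX (flipX^[m] a) = signX a := by
  induction m with
  | zero => rfl
  | succ m ih => rw [Function.iterate_succ_apply', signX_flipX, ih]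

lemma exists_map_to_onQubit_pauliZ {n : ℕ} {A : Finset (Fin n)} {p : Fin n → Fin 4} {i : Fin n}
    (hp : ∀ j ∉ A, p j = 0) (hi : p i ≠ 0) :
    ∃ D, CliffordOn A (min 1 (A.card - 1)) D ∧
      PhaseEq (conj D (pauliString p)) (onQubit i pauliZ) ∧
      (signX (p i) ≠ 1 → PhaseEq (conj D (onQubit i pauliX)) (onQubit i pauliX)) := by
  set T : Finset (Fin n) := Finset.univ.filter (fun j => p j ≠ 0) with hT
  have hTA : T ⊆ A := fun j hj => by
    by_contra h
    exact (Finset.mem_filter.mp hj).2 (hp j h)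
  -- Z at i and X on the rest of the support: the only anticommuting qubit is i, so the gate
  -- multiplies each other X by one more X.
  set q : Fin n → Fin 4 := fun j => if j = i then 3 else if p j ≠ 0 then 1 else 0 with hq
  have hqi : q i = 3 := by simp [hq]
  have hs3 : signX 3 ≠ 1 := (signX_ne_one_iff 3).mpr (Or.inr rfl)
  have hN : T.filter (fun j => signX (q j) ≠ 1) = {i} := by
    ext j
    by_cases hj : j = i
    · subst hj; simp [hT, hi, hqi, hs3]
    · by_cases h0 : p j = 0 <;> simp [hT, hq, hj, h0, signX]
  have hR : T.filter (fun j => signX (q j) = 1) = T.erase i := by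
    ext j
    by_cases hj : j = i
    · subst hj; simp [hqi, hs3]
    · by_cases h0 : p j = 0 <;> simp [hT, hq, hj, h0, signX]
  obtain ⟨D₁, hD₁, h₁, hx₁⟩ := exists_local_map (A := A) (p := p) (q := q)
    (fun j => by
      by_cases hj : j = i
      · subst hj; simp [hqi, hi]
      · simp [hq, hj]) hp
  have h₂ := GMS_conj_pauliString T q
  rw [hN, hR] at h₂
  set e : Fin n → ℕ := ∑ t ∈ ({i} : Finset (Fin n)) ×ˢ T.erase i,
    (Pi.single t.1 1 + Pi.single t.2 1) with he
  have hej : ∀ j ≠ i, e j = if p j ≠ 0 then 1 else 0 := by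
    intro j hj
    rw [he, Finset.sum_apply, Finset.singleton_product, Finset.sum_map]
    simp [Pi.single_apply, hj, hT]
  have h₃ := h₂.trans (phaseEq_pauliString_mul_xString q e)
  set r : Fin n → Fin 4 := fun l => flipX^[e l] (q l) with hr
  have hrj : ∀ j ≠ i, r j = 0 := by
    intro j hj
    simp only [hr, hej j hj]
    by_cases h0 : p j = 0 <;> simp [hq, hj, h0, flipX]
  -- The exponent of X at i is |T| - 1, of unknown parity, so the factor there may be Y or Z. Both
  -- anticommute with X, which is all that is needed.
  have hri : signX (r i) ≠ 1 := by
    simp only [hr]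
    rw [signX_iterate_flipX, hqi]
    exact hs3
  have hri0 : r i ≠ 0 := fun h => hri (by rw [h]; simp [signX])
  have hiA : i ∈ A := by
    by_contra h
    exact hi (hp i h)
  obtain ⟨D₃, hD₃, h₄, hx₃⟩ := exists_local_map (A := A) (p := r)
    (q := Function.update (fun _ => 0) i 3)
    (fun j => by
      by_cases hj : j = i
      · subst hj; simp [hri0]
      · simp [hj, hrj j hj])
    (fun j hj => hrj j fun h => hj (h ▸ hiA))
  have hG : conj (GMS T (Real.pi / 2)) (onQubit i pauliX) = onQubit i pauliX :=
    conj_eq_of_commute (GMS_mem_unitaryGroup _ _)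
      (commute_GMS _ _ _ fun k _ => commute_onQubit_same _ _ _)
  refine ⟨D₃ * (GMS T (Real.pi / 2) * D₁),
    (hD₃.mul ((CliffordOn.gms hTA).mul hD₁)).mono (by omega), ?_, fun hs => ?_⟩
  · rw [conj_mul, conj_mul, h₁, onQubit_pauliZ, ← h₄]
    exact h₃.conj D₃
  · rw [conj_mul, conj_mul]
    have e1 := (hx₁ i hs (by rw [hqi]; exact hs3)).conj (GMS T (Real.pi / 2))
    rw [hG] at e1
    exact (e1.conj D₃).trans (hx₃ i hri (by simpa using hs3))

/-- If the factor at i is trivial, choose j in the support and make its factor Z. The gate on {i, j}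
then multiplies by X_i X_j, which puts X at i. -/
lemma exists_map_ne_zero {n : ℕ} {A : Finset (Fin n)} {p : Fin n → Fin 4} {i : Fin n}
    (hp : ∀ j ∉ A, p j = 0) (hi : i ∈ A) (hp0 : p ≠ 0) :
    ∃ D q, CliffordOn A (min 1 (A.card - 1)) D ∧
      PhaseEq (conj D (pauliString p)) (pauliString q) ∧ q i ≠ 0 := by
  by_cases hpi : p i = 0
  · obtain ⟨j, hj⟩ := Function.ne_iff.mp hp0
    have hjA : j ∈ A := by
      by_contra h
      exact hj (hp j h)
    have hij : i ≠ j := fun h => hj (h ▸ hpi)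
    obtain ⟨D₁, hD₁, h₁, -⟩ := exists_local_map (A := A) (p := p) (q := Function.update p j 3)
      (fun k => by
        by_cases hk : k = j
        · subst hk; simpa using hj
        · simp [hk]) hp
    have hN : ({i, j} : Finset (Fin n)).filter
        (fun k => signX (Function.update p j 3 k) ≠ 1) = {j} := by
      rw [Finset.filter_insert, Finset.filter_singleton]
      simp [hij, hpi, signX]
      norm_num
    have hR : ({i, j} : Finset (Fin n)).filter
        (fun k => signX (Function.update p j 3 k) = 1) = {i} := by
      rw [Finset.filter_insert, Finset.filter_singleton]
      simp [hij, hpi, signX]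
      norm_num
    have h₂ := GMS_conj_pauliString {i, j} (Function.update p j 3)
    rw [hN, hR] at h₂
    have h₃ := h₂.trans (phaseEq_pauliString_mul_xString _ _)
    rw [← h₁, ← conj, ← conj_mul] at h₃
    refine ⟨GMS {i, j} (Real.pi / 2) * D₁, _,
      ((CliffordOn.gms (by simp [Finset.insert_subset_iff, hi, hjA])).mul hD₁).mono (by omega),
      h₃, ?_⟩
    simp [hij, hpi, flipX]
  · exact ⟨1, p, (CliffordOn.one A).mono (Nat.zero_le _), PhaseEq.of_eq (one_conj _), hpi⟩

/-! ### Synthesis of Clifford operators -/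

lemma conj_onQubit {n : ℕ} (i : Fin n) (U V : Matrix (Fin 2) (Fin 2) ℂ) :
    conj (onQubit i U) (onQubit i V) = onQubit i (U * V * Uᴴ) := by
  rw [conj, conjTranspose_onQubit, onQubit_mul, onQubit_mul]

lemma CliffordOn.pauli {n : ℕ} {A : Finset (Fin n)} {i : Fin n} (hi : i ∈ A) (a : Fin 4) :
    CliffordOn A 0 (onQubit i (pauli a)) := by
  refine CliffordOn.tensor (fun j => ?_) fun j hj => ?_
  · by_cases h : j = i
    · subst h; simpa using IsCliffordInvolution.pauli a
    · simpa [h] using IsCliffordInvolution.one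
  · have h : j ≠ i := fun h => hj (h ▸ hi)
    simp [h]

/-- The conjugate of an involution is an involution, which leaves only the phases ±1. -/
lemma eq_or_eq_neg_of_phaseEq_conj {n : ℕ} {D P : Op n}
    (hD : D ∈ Matrix.unitaryGroup (Fin n → Fin 2) ℂ) (hP : P * P = 1)
    (h : PhaseEq (conj D P) P) : conj D P = P ∨ conj D P = -P := by
  obtain ⟨k, hk⟩ := h
  have h1 : conj D P * conj D P = 1 := by rw [← conj_mul_right hD, hP, conj_one hD]
  rw [hk, smul_mul_smul_comm, hP] at h1
  have h2 : Complex.I ^ k * Complex.I ^ k = 1 := by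
    simpa using congrFun (congrFun h1 (fun _ => 0)) (fun _ => 0)
  rcases mul_self_eq_one_iff.mp h2 with h | h
  · left; rw [hk, h, one_smul]
  · right; rw [hk, h, neg_one_smul]

/-- Conjugation by I, X, Z and Y realises the four sign patterns on the pair (X, Z). -/
lemma exists_pauli_signs {n : ℕ} (i : Fin n) {P Q : Op n}
    (hP : P = onQubit i pauliX ∨ P = -onQubit i pauliX)
    (hQ : Q = onQubit i pauliZ ∨ Q = -onQubit i pauliZ) :
    ∃ a, conj (onQubit i (pauli a)) P = onQubit i pauliX ∧
      conj (onQubit i (pauli a)) Q = onQubit i pauliZ := by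
  have hX : ∀ a s, signX a = s → conj (onQubit i (pauli a)) (onQubit i pauliX)
      = s • onQubit i pauliX := fun a s hs => by
    have h1 : pauli a * pauliX * (pauli a)ᴴ = s • pauliX := by
      have h2 : pauli a * pauliX = s • (pauliX * pauli a) := by
        rw [pauliX_mul_pauli, smul_smul, ← hs, signX_mul_self, one_smul]
      rw [h2, conjTranspose_pauli, smul_mul_assoc, mul_assoc, pauli_mul_self, mul_one]
    rw [conj_onQubit, h1, onQubit_smul]
  have hZ : ∀ a s, signZ a = s → conj (onQubit i (pauli a)) (onQubit i pauliZ)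
      = s • onQubit i pauliZ := fun a s hs => by
    have hss : signZ a * signZ a = 1 := by fin_cases a <;> simp [signZ]
    have h1 : pauli a * pauliZ * (pauli a)ᴴ = s • pauliZ := by
      have h2 : pauli a * pauliZ = s • (pauliZ * pauli a) := by
        rw [pauliZ_mul_pauli, smul_smul, ← hs, hss, one_smul]
      rw [h2, conjTranspose_pauli, smul_mul_assoc, mul_assoc, pauli_mul_self, mul_one]
    rw [conj_onQubit, h1, onQubit_smul]
  have key : ∀ a s t, signX a = s → signZ a = t → P = s • onQubit i pauliX →
      Q = t • onQubit i pauliZ → s * s = 1 → t * t = 1 →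
      ∃ a, conj (onQubit i (pauli a)) P = onQubit i pauliX ∧
        conj (onQubit i (pauli a)) Q = onQubit i pauliZ := by
    intro a s t hs ht hP hQ hss htt
    refine ⟨a, ?_, ?_⟩
    · rw [hP, conj_smul, hX a s hs, smul_smul, hss, one_smul]
    · rw [hQ, conj_smul, hZ a t ht, smul_smul, htt, one_smul]
  rcases hP with hP | hP <;> rcases hQ with hQ | hQ
  · exact key 0 1 1 rfl rfl (by rw [hP, one_smul]) (by rw [hQ, one_smul]) (by simp) (by simp)
  · exact key 1 1 (-1) rfl rfl (by rw [hP, one_smul]) (by rw [hQ, neg_one_smul]) (by simp)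
      (by simp)
  · exact key 3 (-1) 1 rfl rfl (by rw [hP, neg_one_smul]) (by rw [hQ, one_smul]) (by simp)
      (by simp)
  · exact key 2 (-1) (-1) rfl rfl (by rw [hP, neg_one_smul]) (by rw [hQ, neg_one_smul]) (by simp)
      (by simp)

/-- A Clifford operator on `A` is brought to one acting trivially on `i`. -/
lemma exists_map_commute {n : ℕ} {A : Finset (Fin n)} {C : Op n} (hC : IsCliffordOn A C)
    {i : Fin n} (hi : i ∈ A) :
    ∃ D, CliffordOn A (3 * min 1 (A.card - 1)) D ∧ Commute (D * C) (onQubit i pauliX) ∧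
      Commute (D * C) (onQubit i pauliZ) := by
  obtain ⟨p, hp⟩ := hC.conj_mem (Function.update (fun _ => 0) i 1)
  rw [← onQubit_pauliX] at hp
  have hp0 : p ≠ 0 := by
    rintro rfl
    apply not_commute_conj_pauli hC.unitary i
    obtain ⟨k, hk⟩ := hp
    rw [hk, show pauliString (0 : Fin n → Fin 4) = 1 from pauliString_zero]
    exact (Commute.one_left _).smul_left _
  obtain ⟨D₁, p₁, hD₁, h₁, hp₁⟩ := exists_map_ne_zero (fun j hj => hC.eq_zero hi hp hj) hi hp0
  have hq₁ := (hp.conj D₁).trans h₁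
  rw [← conj_mul] at hq₁
  have hC₁ := hD₁.toIsCliffordOn.mul hC
  obtain ⟨D₂, hD₂, h₂, -⟩ :=
    exists_map_to_onQubit_pauliZ (fun j hj => hC₁.eq_zero hi hq₁ hj) hp₁
  -- The image of X_i has been reduced to Z_i; a Hadamard-type local gate turns it back into X_i,
  -- without GMS gates.
  obtain ⟨H, hH, hHZ, -⟩ := exists_local_map (A := A)
    (p := Function.update (fun _ => 0) i 3) (q := Function.update (fun _ => 0) i 1)
    (fun j => by
      by_cases hj : j = i
      · subst hj; simp
      · simp [hj])
    (fun j hj => by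
      have h : j ≠ i := fun h => hj (h ▸ hi)
      simp [h])
  rw [← onQubit_pauliX, ← onQubit_pauliZ] at hHZ
  have hq₂ := ((hq₁.conj D₂).trans h₂).conj H
  rw [hHZ, ← conj_mul D₂, ← conj_mul H] at hq₂
  have hC₂ := hH.toIsCliffordOn.mul (hD₂.toIsCliffordOn.mul hC₁)
  obtain ⟨q, hq⟩ := hC₂.conj_mem (Function.update (fun _ => 0) i 3)
  rw [← onQubit_pauliZ] at hq
  -- The image of X_i is now a phase times X_i, and the image of Z_i cannot commute with it. So its
  -- factor at i is Y or Z, the case in which the reduction preserves X_i.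
  have hqi : signX (q i) ≠ 1 := by
    intro h
    apply not_commute_conj_pauli hC₂.unitary i
    obtain ⟨k, hk⟩ := hq₂
    obtain ⟨l, hl⟩ := hq
    rw [hk, hl]
    refine Commute.smul_left (Commute.smul_right ?_ _) _
    have := onQubit_pauliX_mul i q
    rwa [h, one_smul] at this
  have hqi0 : q i ≠ 0 := fun h => hqi (by rw [h]; simp [signX])
  obtain ⟨D₃, hD₃, h₃, hx₃⟩ :=
    exists_map_to_onQubit_pauliZ (fun j hj => hC₂.eq_zero hi hq hj) hqi0
  have hC₃ := hD₃.toIsCliffordOn.mul hC₂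
  have hX := (hq₂.conj D₃).trans (hx₃ hqi)
  have hZ := (hq.conj D₃).trans h₃
  rw [← conj_mul] at hX hZ
  have hXX := onQubit_pauliX_mul_self i
  have hZZ : onQubit i pauliZ * onQubit i pauliZ = 1 := by
    rw [onQubit_pauliZ, pauliString_mul_self]
  obtain ⟨a, haX, haZ⟩ := exists_pauli_signs i (eq_or_eq_neg_of_phaseEq_conj hC₃.unitary hXX hX)
    (eq_or_eq_neg_of_phaseEq_conj hC₃.unitary hZZ hZ)
  have hD₄ := CliffordOn.pauli hi a
  have hC₄ := hD₄.toIsCliffordOn.mul hC₃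
  rw [← conj_mul] at haX haZ
  refine ⟨onQubit i (pauli a) * (D₃ * (H * (D₂ * D₁))),
    (hD₄.mul (hD₃.mul (hH.mul (hD₂.mul hD₁)))).mono (by omega), ?_, ?_⟩
  · simpa only [mul_assoc] using commute_of_conj_eq hC₄.unitary haX
  · simpa only [mul_assoc] using commute_of_conj_eq hC₄.unitary haZ

/-- A Clifford operator on a set of `m` qubits is implemented with at most `3 (m - 1)`
Mølmer-Sørensen gates. -/
theorem IsCliffordOn.implementable {n : ℕ} (hn : 0 < n) (A : Finset (Fin n)) :
    ∀ C, IsCliffordOn A C → Implementable (3 * (A.card - 1)) C := by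
  induction A using Finset.induction_on with
  | empty =>
    intro C hC
    obtain ⟨c, rfl⟩ := exists_eq_smul_one fun j M => hC.commute j (Finset.notMem_empty j) M
    have hc : c * star c = 1 := by
      have := Matrix.mem_unitaryGroup_iff.mp hC.unitary
      rw [Matrix.star_eq_conjTranspose, Matrix.conjTranspose_smul, smul_mul_smul_comm] at this
      simpa using congrFun (congrFun this (fun _ => 0)) (fun _ => 0)
    -- On no qubits the operator is a phase, realised as a local Clifford on qubit 0; this is where
    -- `hn` enters.
    have := Implementable.onQubit (⟨0, hn⟩ : Fin n) (isSingleQubitClifford_smul_one hc)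
    rw [onQubit_smul, onQubit_one] at this
    exact this.mono (Nat.zero_le _)
  | insert i A hi ih =>
    intro C hC
    obtain ⟨D, hD, hX, hZ⟩ := exists_map_commute hC (Finset.mem_insert_self i A)
    have hDC := hD.toIsCliffordOn.mul hC
    have h := ih (D * C)
      { unitary := hDC.unitary
        conj_mem := hDC.conj_mem
        commute := fun j hj M => by
          by_cases hji : j = i
          · subst hji
            exact commute_onQubit_of_pauli hX hZ M
          · exact hDC.commute j (by simp [hji, hj]) M }
    -- C is recovered as Dᴴ (D C), which is why `CliffordOn` counts the gates of the adjoint.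
    have hDD : Dᴴ * D = 1 := Matrix.mem_unitaryGroup_iff'.mp hD.unitary
    have h' := (hD.impl.mul h)
    rw [← mul_assoc, hDD, one_mul] at h'
    refine h'.mono ?_
    -- When `A` is empty, D costs 3 · min 1 0 = 0 gates, so the last qubit is free.
    rw [Finset.card_insert_of_notMem hi]
    omega

lemma IsClifford.isCliffordOn {n : ℕ} {C : Op n} (hC : IsClifford C) :
    IsCliffordOn Finset.univ C where
  unitary := hC.1
  conj_mem p := mem_pauliGroup_iff.mp
    ((hC.2 _).mpr (mem_pauliGroup_iff.mpr ⟨p, PhaseEq.refl _⟩))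
  commute j hj := absurd (Finset.mem_univ j) hj

end Qubits

theorem mainTheorem2 (n : ℕ) (hn : 2 ≤ n) (C : Qubits.Op n) (hC : Qubits.IsClifford C) :
    ∃ c : Qubits.Circuit n,
      Qubits.Circuit.op c = C ∧ (Qubits.Circuit.gmsCount c : ℤ) ≤ 6 * (n : ℤ) - 8 := by
  obtain ⟨c, hc, hcount⟩ :=
    Qubits.IsCliffordOn.implementable (by omega) Finset.univ C hC.isCliffordOn
  rw [Finset.card_univ, Fintype.card_fin] at hcount
  -- 3(n - 1) ≤ 6n - 8 amounts to 3n ≥ 5.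
  exact ⟨c, hc, by omega⟩
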